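/- Let $q$ be an indeterminate. For $s\ge 0$ let $[s]=(1-q^s)/(1-q)$ be the $q$-integer, for $m\ge 0$ let $(x;y)_m=\prod_{j=0}^{m-1}(1-xy^j)$ be the $q$-shifted factorial, let $\Phi_n(q)$ be the $n$-th cyclotomic polynomial, and put $$A_q(k)=[6k+1]\,\frac{(q;q^3)_k^6}{(q^3;q^3)_k^6}\,q^{3k}\qquad(k\ge 0).$$ For rational functions $A,B\in\mathbb{Q}(q)$ and a polynomial $P\in\mathbb{Q}[q]$, write $A\equiv B\pmod{P}$ if $P$ divides, in $\mathbb{Q}[q]$, the numerator of $A-B$ written in lowest terms. Theorem. Let $n$ be a positive integer with $n\equiv 1\pmod 3$. Then, modulo $\Phi_n(q)^6$, $$\sum_{\substack{i,j,k\ge 0\\ i+j+k\le n-1}}A_q(i)A_q(j)A_q(k)\equiv [n]^3\,\frac{(q^2;q^3)_{(n-1)/3}^9}{(q^3;q^3)_{(n-1)/3}^9}\left\{1+3[n]^2\sum_{r=1}^{(n-1)/3}\left(\frac{q^{3r-1}}{[3r-1]^2}-\frac{q^{3r}}{[3r]^2}\right)\right\}.$$ -/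

import Mathlib

/-- The `q`-integer `[s] = (1 - q^s) / (1 - q)` as a rational function of the indeterminate `q`. -/
noncomputable def qInt (s : ℕ) : RatFunc ℚ :=
  (1 - RatFunc.X ^ s) / (1 - RatFunc.X)

/-- The `q`-shifted factorial `(x; y)_m = ∏_{j=0}^{m-1} (1 - x y^j)`. -/
noncomputable def qShifted (x y : RatFunc ℚ) (m : ℕ) : RatFunc ℚ :=
  ∏ j ∈ Finset.range m, (1 - x * y ^ j)

/-- `A_q(k) = [6k+1] (q; q^3)_k^6 / (q^3; q^3)_k^6 * q^{3k}`. -/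
noncomputable def seqA (k : ℕ) : RatFunc ℚ :=
  qInt (6 * k + 1) *
    (qShifted RatFunc.X (RatFunc.X ^ 3) k ^ 6 / qShifted (RatFunc.X ^ 3) (RatFunc.X ^ 3) k ^ 6) *
    RatFunc.X ^ (3 * k)

/-- Congruence of rational functions modulo a polynomial: `A ≡ B (mod P)` if `P` divides the
numerator of `A - B` written in lowest terms. -/
def RatCongr (P : Polynomial ℚ) (A B : RatFunc ℚ) : Prop :=
  P ∣ (A - B).num

/-! Write `n = 3m + 1` and let `v` be the `Φ_n`-adic valuation; "order `r`" below means divisible by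
`Φ_n^r`. For `m < k < n` the factor `1 - q^(3m+1)` occurs in the numerator of `A_q(k)` to the sixth
power, while the denominator is a unit since `3` is prime to `n`. As `n - 1 = 3m`, the triples with
all indices at most `m` all occur in the sum, and any other triple contributes order 6. So the
triple sum is congruent to `S^3`, where `S = ∑_{k ≤ m} A_q(k)` (`map_sum_triples_sub_le`).

It suffices to know `S` to order 4. With `u = q^n + q^(-n) - 2`, which has order 2, replace each
factor `(1 - s)^6` of `A_q(k)` by `(1 - s)^2 ((1 - s)^2 + s u) ((1 - s)^2 - s u)`. The terms linear
in `u` cancel, so the error has order 4. Since `(1 - s)^2 - s u = (1 - s q^n)(1 - s q^(-n))`, the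
new sum is a terminating `₈φ₇` in base `q^3`, and Jackson's formula (`sum_jacksonTerm`, proved by
the Wilf–Zeilberger method) evaluates it as `[n]` times a product. Expanding that product to first
order in `u` gives `S ≡ R` to order 4, where `R = [n] P^3 (1 + T)`, `P` is the quotient of shifted
factorials and `T` has order 2 (`map_sum_seqA_sub_le`).

As `S` and `R` have order 1, `S^3 - R^3` has order `4 + 2 = 6`; replacing `(1 + T)^3` by `1 + 3T`
costs order `3 + 4 = 7` (`map_triple_sum_sub_le`). -/

/-! ### Jackson's terminating `₈φ₇` summation, by a Wilf–Zeilberger certificate. -/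

section Jackson

variable {K : Type*} [Field K]

/-- The ratio of consecutive Pochhammer parts in the sum `jacksonTerm`, with `P = p ^ N` and
`X = p ^ j`. -/
def jacksonRatio (a p w P X : K) : K :=
  (1 - a * X) ^ 2 * ((1 - a * X) ^ 2 - a * X * w) * (a - p * P * X) * (P - X) /
    ((1 - p * X) ^ 2 * ((1 - p * X) ^ 2 - p * X * w) * a * (P - a ^ 2 * X) * (1 - a * p * P * X))

/-- The summand of the terminating very-well-poised `₈φ₇` series in base `p` with parameters
`a; a, a, a y, a / y, p ^ (N + 1) / a, p ^ (-N)`, where `w = y + 1 / y - 2`. -/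
def jacksonTerm (a p w : K) (N k : ℕ) : K :=
  (1 - a * (p ^ k) ^ 2) / (1 - a) * p ^ k *
    ∏ j ∈ Finset.range k, jacksonRatio a p w (p ^ N) (p ^ j)

/-- The factors of the product side of Jackson's summation formula, with `Z = p ^ (j + 1)`. -/
def jacksonValueRatio (a w Z : K) : K :=
  (1 - a * Z) * (a - Z) * ((a - Z) ^ 2 - a * Z * w) /
    (a * (1 - Z) * (a ^ 2 - Z) * ((1 - Z) ^ 2 - Z * w))

/-- The quotient of the Pochhammer parts of `jacksonTerm` at `N + 1` and at `N`, with
`Z = p ^ (N + 1)` and `X = p ^ k`. -/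
def jacksonShift (a Z X : K) : K :=
  (a - Z * X) * (Z - 1) * (Z - a ^ 2 * X) * (1 - a * Z) /
    ((a - Z) * (Z - X) * (Z - a ^ 2) * (1 - a * Z * X))

theorem jacksonShift_one {a Z : K} (h1 : a - Z ≠ 0) (h2 : Z - 1 ≠ 0) (h3 : Z - a ^ 2 ≠ 0)
    (h4 : 1 - a * Z ≠ 0) : jacksonShift a Z 1 = 1 := by
  unfold jacksonShift
  rw [mul_one, mul_one, mul_one]
  exact (div_eq_one_iff_eq (by simp [*])).2 (by ring)

/-- Going from `(N, k)` to `(N + 1, k + 1)` gives the same factor along either path; this is the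
induction step of `prod_jacksonRatio_succ`. -/
theorem jacksonShift_mul_jacksonRatio {a p w P X : K} (hp : p ≠ 0) (ha : a ≠ 0)
    (h1 : a - p * P ≠ 0)
    (h2 : P - X ≠ 0) (h3 : p * P - X ≠ 0) (h4 : p * P - a ^ 2 ≠ 0) (h5 : 1 - a * (p * P) * X ≠ 0)
    (h6 : 1 - a * (p * P) * (p * X) ≠ 0) (h7 : P - a ^ 2 * X ≠ 0) (h8 : p * P - a ^ 2 * X ≠ 0)
    (h9 : 1 - p * X ≠ 0) (h10 : (1 - p * X) ^ 2 - p * X * w ≠ 0) :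
    jacksonShift a (p * P) X * jacksonRatio a p w (p * P) X =
      jacksonRatio a p w P X * jacksonShift a (p * P) (p * X) := by
  unfold jacksonRatio jacksonShift
  have e1 : p * P - p * X = p * (P - X) := by ring
  have e2 : p * P - a ^ 2 * (p * X) = p * (P - a ^ 2 * X) := by ring
  have e3 : 1 - a * p * P * X = 1 - a * (p * P) * X := by ring
  have e4 : 1 - a * p * (p * P) * X = 1 - a * (p * P) * (p * X) := by ring
  have e5 : a - p * (p * P) * X = a - p * P * (p * X) := by ring
  rw [e1, e2, e3, e4, e5]
  generalize 1 - a * (p * P) * (p * X) = A at *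
  generalize 1 - a * (p * P) * X = B at *
  generalize p * P - a ^ 2 * X = C at *
  generalize P - a ^ 2 * X = D at *
  generalize P - X = E at *
  generalize p * P - X = F at *
  generalize p * P - a ^ 2 = G at *
  generalize (1 - p * X) ^ 2 - p * X * w = H at *
  generalize 1 - p * X = I at *
  generalize a - p * P = J at *
  field_simp

/-- The constant of the Wilf–Zeilberger certificate, with `Z = p ^ (N + 1)`. -/
def jacksonCertConst (a w Z : K) : K :=
  -Z * (a - Z ^ 2) * (1 - a * Z) /
    ((1 - a) * (a - Z) * (1 - Z) * (a ^ 2 - Z) * ((1 - Z) ^ 2 - Z * w))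

/-- The Wilf–Zeilberger equation `G(k + 1) - G(k) = F(N + 1, k) - V F(N, k)` divided by the
Pochhammer part of `F(N, k)`, with `F` the summand, `V` the value ratio and `X = p ^ k`. -/
theorem jackson_certificate {a w Z X : K} (ha : a ≠ 0) (h0 : 1 - a ≠ 0) (h1 : a - Z ≠ 0)
    (h2 : 1 - Z ≠ 0) (h3 : a ^ 2 - Z ≠ 0) (h4 : (1 - Z) ^ 2 - Z * w ≠ 0)
    (h5 : Z - X ≠ 0) (h6 : 1 - a * Z * X ≠ 0) :
    jacksonCertConst a w Z * ((1 - a * X) ^ 2 * ((1 - a * X) ^ 2 - a * X * w) * (a - Z * X) /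
        (a * (1 - a * Z * X)) -
      (1 - X) ^ 2 * ((1 - X) ^ 2 - X * w) * (Z - a ^ 2 * X) / (Z - X)) =
    (1 - a * X ^ 2) / (1 - a) * X * (jacksonShift a Z X - jacksonValueRatio a w Z) := by
  unfold jacksonCertConst jacksonShift jacksonValueRatio
  have e : Z - a ^ 2 = - (a ^ 2 - Z) := by ring
  rw [e]
  obtain ⟨A, hA⟩ : ∃ A, A = 1 - a * Z * X := ⟨_, rfl⟩
  obtain ⟨B, hB⟩ : ∃ B, B = Z - X := ⟨_, rfl⟩
  obtain ⟨C, hC⟩ : ∃ C, C = (1 - Z) ^ 2 - Z * w := ⟨_, rfl⟩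
  obtain ⟨D, hD⟩ : ∃ D, D = a ^ 2 - Z := ⟨_, rfl⟩
  obtain ⟨E, hE⟩ : ∃ E, E = 1 - Z := ⟨_, rfl⟩
  obtain ⟨F, hF⟩ : ∃ F, F = a - Z := ⟨_, rfl⟩
  obtain ⟨G, hG⟩ : ∃ G, G = 1 - a := ⟨_, rfl⟩
  rw [← hA] at h6 ⊢
  rw [← hB] at h5 ⊢
  rw [← hC] at h4 ⊢
  rw [← hD] at h3 ⊢
  rw [← hE] at h2 ⊢
  rw [← hF] at h1 ⊢
  rw [← hG] at h0 ⊢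
  field_simp
  -- `D` and `G` divide every term equally and may stay atoms; the other abbreviations must be
  -- expanded.
  rw [hA, hB, hC, hE, hF]
  ring

/-- Identifies the first term of the certificate at `k` with the second at `k + 1`, so that the
certificate telescopes. -/
theorem jacksonRatio_mul_cert {a p w P X : K} (hp : p ≠ 0) (ha : a ≠ 0) (h2 : P - X ≠ 0)
    (h3 : 1 - a * (p * P) * X ≠ 0) (h7 : P - a ^ 2 * X ≠ 0)
    (h9 : 1 - p * X ≠ 0) (h10 : (1 - p * X) ^ 2 - p * X * w ≠ 0) :
    jacksonRatio a p w P X * ((1 - p * X) ^ 2 * ((1 - p * X) ^ 2 - p * X * w) *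
        (p * P - a ^ 2 * (p * X)) / (p * P - p * X)) =
      (1 - a * X) ^ 2 * ((1 - a * X) ^ 2 - a * X * w) * (a - p * P * X) /
        (a * (1 - a * (p * P) * X)) := by
  unfold jacksonRatio
  have e1 : p * P - p * X = p * (P - X) := by ring
  have e2 : p * P - a ^ 2 * (p * X) = p * (P - a ^ 2 * X) := by ring
  have e3 : 1 - a * p * P * X = 1 - a * (p * P) * X := by ring
  rw [e1, e2, e3]
  generalize 1 - a * (p * P) * X = B at *
  generalize P - a ^ 2 * X = D at *
  generalize P - X = E at *
  generalize (1 - p * X) ^ 2 - p * X * w = H at *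
  generalize 1 - p * X = I at *
  field_simp

/-- The boundary case: the extra summand `k = N + 1` of the longer sum cancels what the telescoping
leaves at `k = N`. -/
theorem jackson_last {a p w P : K} (ha : a ≠ 0) (h0 : 1 - a ≠ 0)
    (h1 : a - p * P ≠ 0)
    (h2 : 1 - p * P ≠ 0) (h3 : a ^ 2 - p * P ≠ 0) (h4 : (1 - p * P) ^ 2 - p * P * w ≠ 0)
    (h5 : p * P - P ≠ 0) (h6 : 1 - a * (p * P) * P ≠ 0) (h7 : 1 - a * (p * P) * (p * P) ≠ 0)
    (h8 : p * P - a ^ 2 * P ≠ 0) :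
    jacksonCertConst a w (p * P) * ((1 - a * P) ^ 2 * ((1 - a * P) ^ 2 - a * P * w) *
        (a - p * P * P) / (a * (1 - a * (p * P) * P))) +
      (1 - a * (p * P) ^ 2) / (1 - a) * (p * P) *
        (jacksonShift a (p * P) P * jacksonRatio a p w (p * P) P) = 0 := by
  unfold jacksonCertConst jacksonShift jacksonRatio
  have e1 : 1 - a * p * (p * P) * P = 1 - a * (p * P) * (p * P) := by ring
  have e2 : p * P - a ^ 2 = - (a ^ 2 - p * P) := by ring
  rw [e1, e2]
  obtain ⟨A, hA⟩ : ∃ A, A = 1 - a * (p * P) * P := ⟨_, rfl⟩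
  obtain ⟨B, hB⟩ : ∃ B, B = p * P - P := ⟨_, rfl⟩
  obtain ⟨C, hC⟩ : ∃ C, C = (1 - p * P) ^ 2 - p * P * w := ⟨_, rfl⟩
  obtain ⟨D, hD⟩ : ∃ D, D = a ^ 2 - p * P := ⟨_, rfl⟩
  obtain ⟨E, hE⟩ : ∃ E, E = 1 - p * P := ⟨_, rfl⟩
  obtain ⟨F, hF⟩ : ∃ F, F = a - p * P := ⟨_, rfl⟩
  obtain ⟨G, hG⟩ : ∃ G, G = 1 - a := ⟨_, rfl⟩
  obtain ⟨H, hH⟩ : ∃ H, H = 1 - a * (p * P) * (p * P) := ⟨_, rfl⟩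
  obtain ⟨I, hI⟩ : ∃ I, I = p * P - a ^ 2 * P := ⟨_, rfl⟩
  rw [← hA] at h6 ⊢
  rw [← hB] at h5 ⊢
  rw [← hC] at h4 ⊢
  rw [← hD] at h3 ⊢
  rw [← hE] at h2 ⊢
  rw [← hF] at h1 ⊢
  rw [← hG] at h0 ⊢
  rw [← hH] at h7 ⊢
  rw [← hI] at h8 ⊢
  field_simp
  rw [hE, hH]
  ring

section Sum

variable {a p w : K}

theorem prod_jacksonRatio_succ (ha : a ≠ 0) (hp : p ≠ 0)
    (h1 : ∀ i, 1 - p ^ (i + 1) ≠ 0) (h2 : ∀ i, 1 - a * p ^ i ≠ 0)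
    (h3 : ∀ i, a - p ^ (i + 1) ≠ 0) (h4 : ∀ i j, p ^ i - a ^ 2 * p ^ j ≠ 0)
    (N k : ℕ) (hk : k ≤ N) (hw : ∀ j < k, (1 - p ^ (j + 1)) ^ 2 - p ^ (j + 1) * w ≠ 0) :
    ∏ j ∈ Finset.range k, jacksonRatio a p w (p ^ (N + 1)) (p ^ j) =
      (∏ j ∈ Finset.range k, jacksonRatio a p w (p ^ N) (p ^ j)) *
        jacksonShift a (p ^ (N + 1)) (p ^ k) := by
  have h5 : ∀ i j, i < j → p ^ j - p ^ i ≠ 0 := by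
    intro i j hij
    obtain ⟨d, rfl⟩ := Nat.exists_eq_add_of_lt hij
    have : p ^ (i + d + 1) - p ^ i = -(p ^ i * (1 - p ^ (d + 1))) := by ring
    rw [this]
    exact neg_ne_zero.2 (mul_ne_zero (pow_ne_zero _ hp) (h1 d))
  induction k with
  | zero =>
    rw [pow_zero, jacksonShift_one (h3 N) (by simpa using h5 0 (N + 1) (by omega))
      (by simpa using h4 (N + 1) 0) (h2 (N + 1))]
    simp
  | succ k ih =>
    rw [Finset.prod_range_succ, Finset.prod_range_succ, ih (by omega) (fun j hj => hw j (by omega)),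
      mul_assoc, mul_assoc, pow_succ' p N, pow_succ' p k]
    congr 1
    have f2 := h2 (N + 1 + k)
    have f3 := h2 (N + 1 + (k + 1))
    rw [pow_add, pow_succ', ← mul_assoc] at f2 f3
    rw [pow_succ'] at f3
    have f4 := h4 (N + 1) 0
    rw [pow_zero, mul_one, pow_succ'] at f4
    apply jacksonShift_mul_jacksonRatio hp ha _ (h5 k N (by omega)) _ f4 f2 f3 (h4 N k)
    all_goals simp only [← pow_succ']
    exacts [h4 (N + 1) k, h1 k, hw k (by omega), h3 N, h5 k (N + 1) (by omega)]

/-- Jackson's summation of a terminating very-well-poised balanced `₈φ₇` series, for the parameters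
of `jacksonTerm`. -/
theorem sum_jacksonTerm (ha : a ≠ 0) (hp : p ≠ 0)
    (h1 : ∀ i, 1 - p ^ (i + 1) ≠ 0) (h2 : ∀ i, 1 - a * p ^ i ≠ 0)
    (h3 : ∀ i, a - p ^ (i + 1) ≠ 0) (h4 : ∀ i j, p ^ i - a ^ 2 * p ^ j ≠ 0)
    (N : ℕ) (hw : ∀ j < N, (1 - p ^ (j + 1)) ^ 2 - p ^ (j + 1) * w ≠ 0) :
    ∑ k ∈ Finset.range (N + 1), jacksonTerm a p w N k =
      ∏ j ∈ Finset.range N, jacksonValueRatio a w (p ^ (j + 1)) := by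
  have h0 : 1 - a ≠ 0 := by simpa using h2 0
  have h5 : ∀ i j, i < j → p ^ j - p ^ i ≠ 0 := by
    intro i j hij
    obtain ⟨d, rfl⟩ := Nat.exists_eq_add_of_lt hij
    have : p ^ (i + d + 1) - p ^ i = -(p ^ i * (1 - p ^ (d + 1))) := by ring
    rw [this]
    exact neg_ne_zero.2 (mul_ne_zero (pow_ne_zero _ hp) (h1 d))
  induction N with
  | zero => simp [jacksonTerm, h0]
  | succ N ih =>
    have hw' : ∀ j < N, (1 - p ^ (j + 1)) ^ 2 - p ^ (j + 1) * w ≠ 0 :=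
      fun j hj => hw j (by omega)
    have f4 : a ^ 2 - p ^ (N + 1) ≠ 0 := by
      rw [← neg_ne_zero, neg_sub]
      simpa using h4 (N + 1) 0
    have f2 : ∀ k, 1 - a * p ^ (N + 1) * p ^ k ≠ 0 := by
      intro k
      rw [mul_assoc, ← pow_add]
      exact h2 _
    have shift : ∀ k ≤ N, jacksonTerm a p w (N + 1) k - jacksonTerm a p w N k *
          jacksonValueRatio a w (p ^ (N + 1)) =
        (∏ j ∈ Finset.range k, jacksonRatio a p w (p ^ N) (p ^ j)) *
          (jacksonCertConst a w (p ^ (N + 1)) *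
            ((1 - a * p ^ k) ^ 2 * ((1 - a * p ^ k) ^ 2 - a * p ^ k * w) *
                (a - p ^ (N + 1) * p ^ k) / (a * (1 - a * p ^ (N + 1) * p ^ k)) -
              (1 - p ^ k) ^ 2 * ((1 - p ^ k) ^ 2 - p ^ k * w) *
                (p ^ (N + 1) - a ^ 2 * p ^ k) / (p ^ (N + 1) - p ^ k))) := by
      intro k hk
      rw [jackson_certificate ha h0 (h3 N) (h1 N) f4 (hw N (by omega)) (h5 k (N + 1) (by omega))
        (f2 k), jacksonTerm, jacksonTerm,
        prod_jacksonRatio_succ ha hp h1 h2 h3 h4 N k hk (fun j hj => hw j (by omega))]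
      ring
    -- `k = N` is excluded: there the factor `p ^ N - p ^ k` of the ratio and the denominator `p ^
    -- (N + 1) - p ^ (k + 1)` both vanish. `last` treats that end in cancelled form.
    have cert : ∀ k < N, (∏ j ∈ Finset.range (k + 1), jacksonRatio a p w (p ^ N) (p ^ j)) *
          ((1 - p ^ (k + 1)) ^ 2 * ((1 - p ^ (k + 1)) ^ 2 - p ^ (k + 1) * w) *
            (p ^ (N + 1) - a ^ 2 * p ^ (k + 1)) / (p ^ (N + 1) - p ^ (k + 1))) =
        (∏ j ∈ Finset.range k, jacksonRatio a p w (p ^ N) (p ^ j)) *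
          ((1 - a * p ^ k) ^ 2 * ((1 - a * p ^ k) ^ 2 - a * p ^ k * w) *
                (a - p ^ (N + 1) * p ^ k) / (a * (1 - a * p ^ (N + 1) * p ^ k))) := by
      intro k h
      rw [Finset.prod_range_succ, mul_assoc]
      congr 1
      have g1 := h1 k
      have g2 := hw k (by omega)
      have g3 := f2 k
      rw [pow_succ' p k] at g1 g2
      rw [pow_succ'] at g3
      rw [pow_succ' p N, pow_succ' p k]
      exact jacksonRatio_mul_cert hp ha (h5 k N h) g3 (h4 N k) g1 g2
    have partialSum : ∀ k ≤ N, ∑ j ∈ Finset.range k, (jacksonTerm a p w (N + 1) j -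
          jacksonTerm a p w N j * jacksonValueRatio a w (p ^ (N + 1))) =
        jacksonCertConst a w (p ^ (N + 1)) *
          ((∏ j ∈ Finset.range k, jacksonRatio a p w (p ^ N) (p ^ j)) *
            ((1 - p ^ k) ^ 2 * ((1 - p ^ k) ^ 2 - p ^ k * w) *
              (p ^ (N + 1) - a ^ 2 * p ^ k) / (p ^ (N + 1) - p ^ k))) := by
      intro k
      induction k with
      -- The certificate vanishes at `k = 0` through its factor `(1 - p ^ k) ^ 2`.
      | zero => intro; simp
      | succ k ihk =>
        intro hk
        rw [Finset.sum_range_succ, ihk (by omega), shift k (by omega), cert k (by omega)]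
        ring
    have last : jacksonTerm a p w (N + 1) (N + 1) =
        -((∏ j ∈ Finset.range N, jacksonRatio a p w (p ^ N) (p ^ j)) *
          (jacksonCertConst a w (p ^ (N + 1)) *
            ((1 - a * p ^ N) ^ 2 * ((1 - a * p ^ N) ^ 2 - a * p ^ N * w) *
                (a - p ^ (N + 1) * p ^ N) / (a * (1 - a * p ^ (N + 1) * p ^ N))))) := by
      have key := jackson_last (a := a) (p := p) (w := w) (P := p ^ N) ha h0
        (by simpa only [← pow_succ'] using h3 N) (by simpa only [← pow_succ'] using h1 N)
        (by simpa only [← pow_succ'] using f4)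
        (by simpa only [← pow_succ'] using hw N (by omega))
        (by simpa only [← pow_succ'] using h5 N (N + 1) (by omega))
        (by simpa only [← pow_succ'] using f2 N) (by simpa only [← pow_succ'] using f2 (N + 1))
        (by simpa only [← pow_succ'] using h4 (N + 1) N)
      simp only [← pow_succ'] at key
      rw [jacksonTerm, Finset.prod_range_succ, prod_jacksonRatio_succ ha hp h1 h2 h3 h4 N N le_rfl
        (fun j hj => hw j (by omega))]
      linear_combination (∏ j ∈ Finset.range N, jacksonRatio a p w (p ^ N) (p ^ j)) * key
    rw [Finset.prod_range_succ, ← ih hw', Finset.sum_range_succ _ (N + 1), last, Finset.sum_mul,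
      ← sub_eq_zero, add_sub_right_comm, ← Finset.sum_sub_distrib, Finset.sum_range_succ,
      partialSum N le_rfl, shift N le_rfl]
    ring

end Sum

end Jackson

/-! ### Congruences expressed as valuation bounds. -/

section Valuation

variable {K Γ₀ : Type*} [Field K] [LinearOrderedCommGroupWithZero Γ₀] (v : Valuation K Γ₀) {δ : Γ₀}

theorem Valuation.map_mul_sub_mul_le {x x' y y' : K} (hx : v x ≤ 1) (hy' : v y' ≤ 1)
    (h : v (x - x') ≤ δ) (h' : v (y - y') ≤ δ) : v (x * y - x' * y') ≤ δ := by
  have : x * y - x' * y' = x * (y - y') + (x - x') * y' := by ring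
  rw [this]
  refine v.map_add_le ?_ ?_ <;> rw [map_mul]
  · exact (mul_le_of_le_one_left' hx).trans h'
  · exact (mul_le_of_le_one_right' hy').trans h

theorem Valuation.map_div_sub_div_le {x x' y y' : K} (hx' : v x' ≤ 1) (hy : v y = 1)
    (hy' : v y' = 1) (h : v (x - x') ≤ δ) (h' : v (y - y') ≤ δ) : v (x / y - x' / y') ≤ δ := by
  have hy0 : y ≠ 0 := v.ne_zero_iff.1 (by simp [hy])
  have hy0' : y' ≠ 0 := v.ne_zero_iff.1 (by simp [hy'])
  have : x / y - x' / y' = ((x - x') * y' + x' * (y' - y)) / (y * y') := by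
    field_simp; ring
  rw [this, map_div₀, map_mul, hy, hy', mul_one, div_one]
  refine v.map_add_le ?_ ?_ <;> rw [map_mul]
  · rw [hy', mul_one]; exact h
  · rw [v.map_sub_swap]
    exact (mul_le_of_le_one_left' hx').trans h'

theorem Valuation.map_prod_le_one {ι : Type*} {s : Finset ι} {f : ι → K}
    (hf : ∀ i ∈ s, v (f i) ≤ 1) : v (∏ i ∈ s, f i) ≤ 1 := by
  rw [map_prod]
  exact Finset.prod_le_one' hf

theorem Valuation.map_prod_sub_prod_le {ι : Type*} {s : Finset ι} {f g : ι → K}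
    (hf : ∀ i ∈ s, v (f i) ≤ 1) (hg : ∀ i ∈ s, v (g i) ≤ 1) (h : ∀ i ∈ s, v (f i - g i) ≤ δ) :
    v (∏ i ∈ s, f i - ∏ i ∈ s, g i) ≤ δ := by
  classical
  induction s using Finset.induction_on with
  | empty => simp
  | insert a s ha ih =>
    rw [Finset.prod_insert ha, Finset.prod_insert ha]
    simp only [Finset.mem_insert, forall_eq_or_imp] at hf hg h
    exact v.map_mul_sub_mul_le hf.1 (v.map_prod_le_one hg.2) h.1 (ih hf.2 hg.2 h.2)

theorem Valuation.map_eq_one_of_sub_lt {x y : K} (hy : v y = 1) (h : v (x - y) < 1) : v x = 1 := by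
  rw [← hy] at h ⊢
  exact v.map_eq_of_sub_lt h

/-- The product of the `1 + u α i` is `1 + u ∑ α i` up to second order in `u`. -/
theorem Valuation.map_prod_one_add_sub_le {ι : Type*} {s : Finset ι} {α : ι → K} {u : K}
    (hu : v u ≤ 1) (hα : ∀ i ∈ s, v (α i) ≤ 1) :
    v (∏ i ∈ s, (1 + u * α i) - (1 + u * ∑ i ∈ s, α i)) ≤ v u ^ 2 := by
  classical
  induction s using Finset.induction_on with
  | empty => simp
  | insert a s ha ih =>
    rw [Finset.prod_insert ha, Finset.sum_insert ha]
    simp only [Finset.mem_insert, forall_eq_or_imp] at hα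
    have : (1 + u * α a) * ∏ i ∈ s, (1 + u * α i) - (1 + u * (α a + ∑ i ∈ s, α i)) =
        (1 + u * α a) * (∏ i ∈ s, (1 + u * α i) - (1 + u * ∑ i ∈ s, α i)) +
          u ^ 2 * (α a * ∑ i ∈ s, α i) := by ring
    rw [this]
    refine v.map_add_le ?_ ?_ <;> rw [map_mul]
    · refine (mul_le_of_le_one_left' (v.map_add_le (by simp) ?_)).trans (ih hα.2)
      rw [map_mul]
      exact mul_le_one' hu hα.1
    · rw [map_pow]
      refine mul_le_of_le_one_right' ?_
      rw [map_mul]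
      exact mul_le_one' hα.1 (v.map_sum_le hα.2)

/-- The opposite signs make the product even in `u`, so the error is quadratic. -/
theorem Valuation.map_deformed_ratio_sub_le {c d r s u : K} (hc : v c ≤ 1) (hd : v d = 1)
    (hr : v r ≤ 1) (hs : v s ≤ 1) (hu : v u < 1) :
    v (c ^ 2 * (c ^ 2 + r * u) * (c ^ 2 - r * u) / (d ^ 2 * (d ^ 2 + s * u) * (d ^ 2 - s * u)) -
      c ^ 6 / d ^ 6) ≤ v u ^ 2 := by
  have key : ∀ {c r : K}, v c ≤ 1 → v r ≤ 1 →
      v (c ^ 2 * (c ^ 2 + r * u) * (c ^ 2 - r * u) - c ^ 6) ≤ v u ^ 2 := by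
    intro c r hc hr
    have : c ^ 2 * (c ^ 2 + r * u) * (c ^ 2 - r * u) - c ^ 6 = -((c * r) ^ 2 * u ^ 2) := by ring
    rw [this, v.map_neg, map_mul, map_pow, map_mul, map_pow]
    exact mul_le_of_le_one_left' (pow_le_one' (mul_le_one' hc hr) 2)
  have hd6 : v (d ^ 6) = 1 := by simp [hd]
  refine v.map_div_sub_div_le (by rw [map_pow]; exact pow_le_one' hc 6) ?_ hd6 (key hc hr)
    (key hd.le hs)
  exact v.map_eq_one_of_sub_lt hd6 ((key hd.le hs).trans_lt (pow_lt_one' hu two_ne_zero))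

end Valuation

/-! ### Specialization of Jackson's formula to `a = q`, `p = q^3`, `w = -u`. -/

section Specialization

variable {K : Type*} [Field K]

theorem jacksonRatio_eq_deformed_ratio {q t u P X : K} (hq : q ≠ 0) (ht : t ≠ 0)
    (htP : t = q * P) (hu : u = (1 - t) ^ 2 / t) (h1 : P - q ^ 2 * X ≠ 0)
    (h2 : 1 - q * q ^ 3 * P * X ≠ 0) :
    jacksonRatio q (q ^ 3) (-u) P X =
      (1 - q * X) ^ 2 * ((1 - q * X) ^ 2 + q * X * u) * ((1 - q * X) ^ 2 - q * X * u) /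
        ((1 - q ^ 3 * X) ^ 2 * ((1 - q ^ 3 * X) ^ 2 + q ^ 3 * X * u) *
          ((1 - q ^ 3 * X) ^ 2 - q ^ 3 * X * u)) := by
  have hut : u * t = (1 - t) ^ 2 := by rw [hu, div_mul_cancel₀ _ ht]
  -- The factors with `-u` split and produce the terminating parameters; those with `+u` already
  -- carry `w = -u`.
  have e1 : ∀ s : K, (1 - s) ^ 2 - s * u = (t - s) * (1 - t * s) / t := by
    intro s
    rw [eq_div_iff ht]
    linear_combination - s * hut
  have e2 : t - q ^ 3 * X = q * (P - q ^ 2 * X) := by rw [htP]; ring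
  have e3 : t - q * X = q * (P - X) := by rw [htP]; ring
  have e4 : q * (1 - t * (q * X)) = q - q ^ 3 * P * X := by rw [htP]; ring
  have e5 : 1 - t * (q ^ 3 * X) = 1 - q * q ^ 3 * P * X := by rw [htP]; ring
  rw [e1, e1, jacksonRatio, ← e4, e2, e3, e5, mul_neg, mul_neg, sub_neg_eq_add, sub_neg_eq_add]
  generalize 1 - q * q ^ 3 * P * X = A at *
  generalize P - q ^ 2 * X = B at *
  generalize (1 - q ^ 3 * X) ^ 2 + q ^ 3 * X * u = C
  generalize 1 - q ^ 3 * X = D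
  -- `C` and `D` occur in both denominators; if either is `0`, both sides are `0` since division by
  -- zero gives `0`.
  by_cases hC : C = 0
  · simp [hC]
  by_cases hD : D = 0
  · simp [hD]
  field_simp

theorem jacksonValueRatio_eq {q u b c d : K} (hq : q ≠ 0) (hc : c = q * b) (hd : d = q * c)
    (hb1 : 1 - b ≠ 0) (hc1 : 1 - c ≠ 0) (hd1 : 1 - d ≠ 0)
    (hdu : 1 + u * (d / (1 - d) ^ 2) ≠ 0) :
    jacksonValueRatio q (-u) d =
      (1 - q * d) / (1 - b) * ((1 - c) / (1 - d)) ^ 3 *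
        ((1 + u * (c / (1 - c) ^ 2)) / (1 + u * (d / (1 - d) ^ 2))) := by
  have e1 : q - d = q * (1 - c) := by rw [hd]; ring
  have e2 : q ^ 2 - d = q ^ 2 * (1 - b) := by rw [hd, hc]; ring
  have e3 : (1 - d) ^ 2 - d * -u = (1 - d) ^ 2 * (1 + u * (d / (1 - d) ^ 2)) := by
    field_simp; ring
  have e4 : (q * (1 - c)) ^ 2 - q * d * -u =
      q ^ 2 * (1 - c) ^ 2 * (1 + u * (c / (1 - c) ^ 2)) := by
    rw [hd]; field_simp; ring
  rw [jacksonValueRatio, e1, e4, e2, e3]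
  generalize 1 + u * (d / (1 - d) ^ 2) = A at *
  generalize 1 - d = B at *
  generalize 1 - c = C at *
  generalize 1 - b = D at *
  field_simp

end Specialization

/-! ### Comparison of `A_q(k)` with the Jackson summand modulo `Φ_n^4`. -/

section Congruence

open RatFunc

theorem RatFunc.one_sub_X_pow_ne_zero {j : ℕ} (hj : j ≠ 0) : (1 - X ^ j : RatFunc ℚ) ≠ 0 := by
  have : (1 - X ^ j : RatFunc ℚ) = algebraMap (Polynomial ℚ) (RatFunc ℚ) (1 - Polynomial.X ^ j) := by
    simp
  rw [this]
  refine RatFunc.algebraMap_ne_zero fun h => ?_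
  have := congrArg (Polynomial.eval 0) h
  simp [hj] at this

theorem RatFunc.X_pow_sub_X_pow_ne_zero {i j : ℕ} (hij : i ≠ j) :
    (X ^ i - X ^ j : RatFunc ℚ) ≠ 0 := by
  have aux : ∀ {i j : ℕ}, i < j → (X ^ i - X ^ j : RatFunc ℚ) ≠ 0 := by
    intro i j h
    obtain ⟨d, rfl⟩ := Nat.exists_eq_add_of_lt h
    have : (X ^ i - X ^ (i + d + 1) : RatFunc ℚ) = X ^ i * (1 - X ^ (d + 1)) := by ring
    rw [this]
    exact mul_ne_zero (pow_ne_zero _ RatFunc.X_ne_zero) (one_sub_X_pow_ne_zero (by omega))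
  rcases lt_or_gt_of_ne hij with h | h
  · exact aux h
  · rw [← neg_ne_zero, neg_sub]; exact aux h

variable {Γ₀ : Type*} [LinearOrderedCommGroupWithZero Γ₀] {v : Valuation (RatFunc ℚ) Γ₀}
  {m n : ℕ}

/-- The quantity `x + 1 / x - 2` at `x = q ^ n`. Replacing factors `(1 - s) ^ 2` of `seqA` by
`(1 - s) ^ 2 ± s * deformation n` turns `seqA` into a summand of Jackson's formula. -/
noncomputable def deformation (n : ℕ) : RatFunc ℚ := (1 - X ^ n) ^ 2 / X ^ n

theorem Valuation.map_one_sub_X_pow_le_one (hX : v X = 1) (j : ℕ) : v (1 - X ^ j) ≤ 1 :=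
  v.map_sub_le (by simp) (by simp [hX])

theorem Valuation.map_deformation (hX : v X = 1) : v (deformation n) = v (1 - X ^ n) ^ 2 := by
  simp [deformation, hX]

theorem not_dvd_three_mul (hnm : n = 3 * m + 1) {j : ℕ} (h0 : j ≠ 0) (hj : j < n) :
    ¬ n ∣ 3 * j := by
  have h3 : Nat.Coprime n 3 := by
    rw [hnm]; simp
  intro h
  exact Nat.not_dvd_of_pos_of_lt (Nat.pos_of_ne_zero h0) hj (h3.dvd_of_dvd_mul_left h)

theorem map_one_sub_X_pow_three_mul (hnm : n = 3 * m + 1)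
    (h1 : ∀ j, ¬ n ∣ j → v (1 - X ^ j) = 1) {j : ℕ} (hj : j + 1 < n) :
    v (1 - X ^ (3 * j + 3)) = 1 := by
  refine h1 _ ?_
  rw [show 3 * j + 3 = 3 * (j + 1) by ring]
  exact not_dvd_three_mul hnm (by omega) hj

theorem qShifted_pow_three (s m : ℕ) :
    qShifted (X ^ s) (X ^ 3) m = ∏ j ∈ Finset.range m, (1 - X ^ (3 * j + s)) := by
  refine Finset.prod_congr rfl fun j _ => ?_
  ring

theorem seqA_eq (k : ℕ) :
    seqA k = (1 - X ^ (6 * k + 1)) / (1 - X) * X ^ (3 * k) *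
      ∏ j ∈ Finset.range k, (1 - X ^ (3 * j + 1)) ^ 6 / (1 - X ^ (3 * j + 3)) ^ 6 := by
  have h := qShifted_pow_three 1 k
  rw [pow_one] at h
  rw [seqA, h, qShifted_pow_three, qInt, ← Finset.prod_pow, ← Finset.prod_pow,
    ← Finset.prod_div_distrib]
  ring

theorem jacksonTerm_X_eq (hnm : n = 3 * m + 1) (k : ℕ) :
    jacksonTerm X (X ^ 3) (-deformation n) m k = (1 - X ^ (6 * k + 1)) / (1 - X) * X ^ (3 * k) *
      ∏ j ∈ Finset.range k,
        ((1 - X ^ (3 * j + 1)) ^ 2 *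
            ((1 - X ^ (3 * j + 1)) ^ 2 + X ^ (3 * j + 1) * deformation n) *
            ((1 - X ^ (3 * j + 1)) ^ 2 - X ^ (3 * j + 1) * deformation n) /
          ((1 - X ^ (3 * j + 3)) ^ 2 *
            ((1 - X ^ (3 * j + 3)) ^ 2 + X ^ (3 * j + 3) * deformation n) *
            ((1 - X ^ (3 * j + 3)) ^ 2 - X ^ (3 * j + 3) * deformation n))) := by
  rw [jacksonTerm]
  congr 1
  · ring
  · refine Finset.prod_congr rfl fun j _ => ?_
    have hX : (X : RatFunc ℚ) ≠ 0 := X_ne_zero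
    rw [jacksonRatio_eq_deformed_ratio (t := X ^ n) (u := deformation n) hX (pow_ne_zero _ hX) _ rfl]
    · ring
    · have := X_pow_sub_X_pow_ne_zero (show 3 * m ≠ 2 + 3 * j by omega)
      rwa [pow_mul, pow_add, pow_mul] at this
    · have := one_sub_X_pow_ne_zero (show 4 + 3 * m + 3 * j ≠ 0 by omega)
      convert this using 1
      ring
    · rw [hnm]; ring

theorem map_seqA_sub_jacksonTerm_le (hnm : n = 3 * m + 1) (hX : v X = 1)
    (h1 : ∀ j, ¬ n ∣ j → v (1 - X ^ j) = 1) (hn : v (1 - X ^ n) < 1) (hm : m ≠ 0)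
    {k : ℕ} (hk : k ≤ m) :
    v (seqA k - jacksonTerm X (X ^ 3) (-deformation n) m k) ≤ v (1 - X ^ n) ^ 4 := by
  have hu : v (deformation n) < 1 := by
    rw [v.map_deformation hX]; exact pow_lt_one' hn two_ne_zero
  have hX1 : v (1 - X) = 1 := by
    simpa using h1 1 (by rw [Nat.dvd_one]; omega)
  have key : ∀ j ∈ Finset.range k, v (((1 - X ^ (3 * j + 1)) ^ 2 *
            ((1 - X ^ (3 * j + 1)) ^ 2 + X ^ (3 * j + 1) * deformation n) *
            ((1 - X ^ (3 * j + 1)) ^ 2 - X ^ (3 * j + 1) * deformation n) /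
          ((1 - X ^ (3 * j + 3)) ^ 2 *
            ((1 - X ^ (3 * j + 3)) ^ 2 + X ^ (3 * j + 3) * deformation n) *
            ((1 - X ^ (3 * j + 3)) ^ 2 - X ^ (3 * j + 3) * deformation n))) -
        (1 - X ^ (3 * j + 1)) ^ 6 / (1 - X ^ (3 * j + 3)) ^ 6) ≤ v (1 - X ^ n) ^ 4 := by
    intro j hj
    rw [Finset.mem_range] at hj
    rw [show v (1 - X ^ n) ^ 4 = v (deformation n) ^ 2 by
      rw [v.map_deformation hX, ← pow_mul]]
    exact v.map_deformed_ratio_sub_le (v.map_one_sub_X_pow_le_one hX _)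
      (map_one_sub_X_pow_three_mul hnm h1 (by omega)) (by simp [hX]) (by simp [hX]) hu
  have hle : ∀ j ∈ Finset.range k,
      v ((1 - X ^ (3 * j + 1)) ^ 6 / (1 - X ^ (3 * j + 3)) ^ 6) ≤ 1 := by
    intro j hj
    rw [Finset.mem_range] at hj
    rw [map_div₀, map_pow, map_pow, map_one_sub_X_pow_three_mul hnm h1 (by omega), one_pow,
      div_one]
    exact pow_le_one' (v.map_one_sub_X_pow_le_one hX _) 6
  have h4 : v (1 - X ^ n) ^ 4 ≤ 1 := pow_le_one' hn.le 4
  rw [v.map_sub_swap, seqA_eq, jacksonTerm_X_eq hnm, ← mul_sub, map_mul]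
  refine (mul_le_of_le_one_left' ?_).trans (v.map_prod_sub_prod_le ?_ hle key)
  · rw [map_mul, map_div₀, hX1, div_one, map_pow, hX, one_pow, mul_one]
    exact v.map_one_sub_X_pow_le_one hX _
  · intro j hj
    rw [← sub_add_cancel (_ / _) ((1 - X ^ (3 * j + 1)) ^ 6 / (1 - X ^ (3 * j + 3)) ^ 6)]
    exact v.map_add_le ((key j hj).trans h4) (hle j hj)

end Congruence

/-! ### Evaluation of the deformed sum and its first-order expansion. -/

section Congruence

open RatFunc

variable {Γ₀ : Type*} [LinearOrderedCommGroupWithZero Γ₀] {v : Valuation (RatFunc ℚ) Γ₀}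
  {m n : ℕ}

theorem map_deformed_factor (hnm : n = 3 * m + 1) (hX : v X = 1)
    (h1 : ∀ j, ¬ n ∣ j → v (1 - X ^ j) = 1) (hn : v (1 - X ^ n) < 1) {j : ℕ} (hj : j < m) :
    v (1 + deformation n * (X ^ (3 * j + 3) / (1 - X ^ (3 * j + 3)) ^ 2)) = 1 := by
  refine v.map_eq_one_of_sub_lt v.map_one ?_
  rw [add_sub_cancel_left, map_mul, map_div₀, map_pow, map_pow, hX,
    map_one_sub_X_pow_three_mul hnm h1 (by omega), v.map_deformation hX]
  simpa using pow_lt_one' hn two_ne_zero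

/-- The product telescopes; it is the source of the factor `[n]` in the value. -/
theorem prod_one_sub_X_pow_div (m : ℕ) :
    ∏ j ∈ Finset.range m, (1 - X ^ (3 * j + 4) : RatFunc ℚ) / (1 - X ^ (3 * j + 1)) =
      qInt (3 * m + 1) := by
  induction m with
  | zero =>
    have := one_sub_X_pow_ne_zero one_ne_zero
    rw [pow_one] at this
    simp [qInt, this]
  | succ m ih =>
    have := one_sub_X_pow_ne_zero (show 3 * m + 1 ≠ 0 by omega)
    rw [Finset.prod_range_succ, ih, qInt, qInt, show 3 * (m + 1) + 1 = 3 * m + 4 by ring]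
    field_simp

theorem sum_jacksonTerm_X (hnm : n = 3 * m + 1) (hX : v X = 1)
    (h1 : ∀ j, ¬ n ∣ j → v (1 - X ^ j) = 1) (hn : v (1 - X ^ n) < 1) :
    ∑ k ∈ Finset.range (m + 1), jacksonTerm X (X ^ 3) (-deformation n) m k =
      qInt n * ((∏ j ∈ Finset.range m, (1 - X ^ (3 * j + 2))) /
          ∏ j ∈ Finset.range m, (1 - X ^ (3 * j + 3))) ^ 3 *
        ((∏ j ∈ Finset.range m,
            (1 + deformation n * (X ^ (3 * j + 2) / (1 - X ^ (3 * j + 2)) ^ 2))) /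
          ∏ j ∈ Finset.range m,
            (1 + deformation n * (X ^ (3 * j + 3) / (1 - X ^ (3 * j + 3)) ^ 2))) := by
  have hX0 : (X : RatFunc ℚ) ≠ 0 := X_ne_zero
  have hd : ∀ j < m, 1 + deformation n * (X ^ (3 * j + 3) / (1 - X ^ (3 * j + 3)) ^ 2) ≠ 0 :=
    fun j hj => v.ne_zero_iff.1 (by rw [map_deformed_factor hnm hX h1 hn hj]; exact one_ne_zero)
  have hpow : ∀ j, ((X : RatFunc ℚ) ^ 3) ^ (j + 1) = X ^ (3 * j + 3) := fun j => by ring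
  rw [sum_jacksonTerm hX0 (pow_ne_zero _ hX0)]
  · rw [hnm, ← prod_one_sub_X_pow_div, ← hnm, ← Finset.prod_div_distrib, ← Finset.prod_div_distrib,
      ← Finset.prod_pow, ← Finset.prod_mul_distrib, ← Finset.prod_mul_distrib]
    refine Finset.prod_congr rfl fun j hj => ?_
    rw [Finset.mem_range] at hj
    rw [hpow, jacksonValueRatio_eq (b := X ^ (3 * j + 1)) (c := X ^ (3 * j + 2)) hX0 (by ring)
      (by ring) (one_sub_X_pow_ne_zero (by omega)) (one_sub_X_pow_ne_zero (by omega))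
      (one_sub_X_pow_ne_zero (by omega)) (hd j hj), ← pow_succ']
  · intro i
    rw [hpow]
    exact one_sub_X_pow_ne_zero (by omega)
  · intro i
    rw [← pow_mul, ← pow_succ']
    exact one_sub_X_pow_ne_zero (by omega)
  · intro i
    rw [hpow]
    simpa using X_pow_sub_X_pow_ne_zero (show 1 ≠ 3 * i + 3 by omega)
  · intro i j
    rw [← pow_mul, ← pow_mul, ← pow_add]
    exact X_pow_sub_X_pow_ne_zero (by omega)
  · intro j hj
    have h := one_sub_X_pow_ne_zero (show 3 * j + 3 ≠ 0 by omega)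
    have e : (1 - X ^ (3 * j + 3)) ^ 2 - X ^ (3 * j + 3) * -deformation n =
        (1 - X ^ (3 * j + 3)) ^ 2 *
          (1 + deformation n * (X ^ (3 * j + 3) / (1 - X ^ (3 * j + 3)) ^ 2)) := by
      field_simp
      ring
    rw [hpow, e]
    exact mul_ne_zero (pow_ne_zero _ h) (hd j hj)

theorem qInt_sq_mul_sum_Icc (n m : ℕ) :
    qInt n ^ 2 * ∑ r ∈ Finset.Icc 1 m,
        (X ^ (3 * r - 1) / qInt (3 * r - 1) ^ 2 - X ^ (3 * r) / qInt (3 * r) ^ 2) =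
      (1 - X ^ n) ^ 2 * ∑ j ∈ Finset.range m, (X ^ (3 * j + 2) / (1 - X ^ (3 * j + 2)) ^ 2 -
        X ^ (3 * j + 3) / (1 - X ^ (3 * j + 3)) ^ 2) := by
  have h := one_sub_X_pow_ne_zero one_ne_zero
  rw [pow_one] at h
  rw [← Finset.Ico_add_one_right_eq_Icc, Finset.sum_Ico_eq_sum_range, Nat.add_sub_cancel,
    Finset.mul_sum, Finset.mul_sum]
  refine Finset.sum_congr rfl fun j _ => ?_
  rw [show 3 * (1 + j) - 1 = 3 * j + 2 by omega, show 3 * (1 + j) = 3 * j + 3 by omega]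
  have h2 := one_sub_X_pow_ne_zero (show 3 * j + 2 ≠ 0 by omega)
  have h3 := one_sub_X_pow_ne_zero (show 3 * j + 3 ≠ 0 by omega)
  unfold qInt
  field_simp

/-- The first-order expansion of the deformed part of the value of Jackson's sum. -/
theorem map_deformed_value_sub_le (hnm : n = 3 * m + 1) (hX : v X = 1)
    (h1 : ∀ j, ¬ n ∣ j → v (1 - X ^ j) = 1) (hn : v (1 - X ^ n) < 1) :
    v ((∏ j ∈ Finset.range m,
            (1 + deformation n * (X ^ (3 * j + 2) / (1 - X ^ (3 * j + 2)) ^ 2))) /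
          (∏ j ∈ Finset.range m,
            (1 + deformation n * (X ^ (3 * j + 3) / (1 - X ^ (3 * j + 3)) ^ 2))) -
        (1 + (1 - X ^ n) ^ 2 * ∑ j ∈ Finset.range m,
          (X ^ (3 * j + 2) / (1 - X ^ (3 * j + 2)) ^ 2 -
            X ^ (3 * j + 3) / (1 - X ^ (3 * j + 3)) ^ 2))) ≤ v (1 - X ^ n) ^ 3 := by
  have hu := v.map_deformation (n := n) hX
  have hX0 : (X : RatFunc ℚ) ≠ 0 := X_ne_zero
  have hu1 : v (deformation n) ≤ 1 := by rw [hu]; exact pow_le_one' hn.le 2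
  have hu3 : v (deformation n) ^ 2 ≤ v (1 - X ^ n) ^ 3 := by
    rw [hu, ← pow_mul]
    exact pow_le_pow_right_of_le_one' hn.le (by norm_num)
  have hβ : ∀ j ∈ Finset.range m, v (X ^ (3 * j + 2) / (1 - X ^ (3 * j + 2)) ^ 2) ≤ 1 := by
    intro j hj
    rw [Finset.mem_range] at hj
    rw [map_div₀, map_pow, map_pow, hX, h1 (3 * j + 2) (Nat.not_dvd_of_pos_of_lt (by omega)
      (by omega))]
    simp
  have hγ : ∀ j ∈ Finset.range m, v (X ^ (3 * j + 3) / (1 - X ^ (3 * j + 3)) ^ 2) ≤ 1 := by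
    intro j hj
    rw [Finset.mem_range] at hj
    rw [map_div₀, map_pow, map_pow, hX, map_one_sub_X_pow_three_mul hnm h1 (by omega)]
    simp
  have hden : v (∏ j ∈ Finset.range m,
      (1 + deformation n * (X ^ (3 * j + 3) / (1 - X ^ (3 * j + 3)) ^ 2))) = 1 := by
    rw [map_prod]
    exact Finset.prod_eq_one fun j hj =>
      map_deformed_factor hnm hX h1 hn (Finset.mem_range.1 hj)
  have b1 := v.map_prod_one_add_sub_le hu1 hβ
  have g1 := v.map_prod_one_add_sub_le hu1 hγ
  have hB := v.map_sum_le hβ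
  have hC := v.map_sum_le hγ
  rw [Finset.sum_sub_distrib]
  generalize (∏ j ∈ Finset.range m,
      (1 + deformation n * (X ^ (3 * j + 2) / (1 - X ^ (3 * j + 2)) ^ 2))) = B at *
  generalize (∏ j ∈ Finset.range m,
      (1 + deformation n * (X ^ (3 * j + 3) / (1 - X ^ (3 * j + 3)) ^ 2))) = C at *
  generalize ∑ j ∈ Finset.range m, (X ^ (3 * j + 2) / (1 - X ^ (3 * j + 2)) ^ 2 : RatFunc ℚ) = β at *
  generalize ∑ j ∈ Finset.range m, (X ^ (3 * j + 3) / (1 - X ^ (3 * j + 3)) ^ 2 : RatFunc ℚ) = γ at *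
  have hC0 : C ≠ 0 := v.ne_zero_iff.1 (by rw [hden]; exact one_ne_zero)
  -- Trading the deformation for `(1 - X ^ n) ^ 2` costs third order, which limits the accuracy of
  -- the whole estimate.
  have hsq : (1 - X ^ n) ^ 2 = deformation n - deformation n * (1 - X ^ n) := by
    rw [deformation]
    field_simp
    ring
  have split : B / C - (1 + (1 - X ^ n) ^ 2 * (β - γ)) =
      ((B - (1 + deformation n * β)) - (C - (1 + deformation n * γ)) *
          (1 + deformation n * (β - γ)) - deformation n ^ 2 * (γ * (β - γ)) ) / C +
        deformation n * (1 - X ^ n) * (β - γ) := by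
    rw [hsq]
    field_simp
    ring
  have hβγ : v (β - γ) ≤ 1 := v.map_sub_le hB hC
  rw [split]
  refine v.map_add_le ?_ ?_
  · rw [map_div₀, hden, div_one]
    refine v.map_sub_le (v.map_sub_le (b1.trans hu3) ?_) ?_
    · rw [map_mul]
      refine (mul_le_of_le_one_right' (v.map_add_le (by simp) ?_)).trans (g1.trans hu3)
      rw [map_mul]
      exact mul_le_one' hu1 hβγ
    · rw [map_mul, map_mul, map_pow]
      exact (mul_le_of_le_one_right' (mul_le_one' hC hβγ)).trans hu3
  · rw [map_mul, map_mul, hu, ← pow_succ]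
    exact mul_le_of_le_one_right' hβγ

end Congruence

/-! ### From the single sum to the triple sum. -/

section Congruence

open RatFunc

variable {Γ₀ : Type*} [LinearOrderedCommGroupWithZero Γ₀] {v : Valuation (RatFunc ℚ) Γ₀}
  {m n : ℕ}

theorem map_qInt (h1 : ∀ j, ¬ n ∣ j → v (1 - X ^ j) = 1) (hn1 : n ≠ 1) (s : ℕ) :
    v (qInt s) = v (1 - X ^ s) := by
  have hX1 : v (1 - X) = 1 := by
    simpa using h1 1 (by rwa [Nat.dvd_one])
  rw [qInt, map_div₀, hX1, div_one]

theorem map_seqA_le (hnm : n = 3 * m + 1) (hX : v X = 1)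
    (h1 : ∀ j, ¬ n ∣ j → v (1 - X ^ j) = 1) (hm : m ≠ 0) {k : ℕ} (hk : k < n) :
    v (seqA k) ≤ ∏ j ∈ Finset.range k, v (1 - X ^ (3 * j + 1)) ^ 6 := by
  have hX1 : v (1 - X) = 1 := by
    simpa using h1 1 (by rw [Nat.dvd_one]; omega)
  rw [seqA_eq, map_mul, map_mul, map_div₀, hX1, div_one, map_pow, hX, one_pow, mul_one, map_prod]
  refine mul_le_of_le_one_of_le (v.map_one_sub_X_pow_le_one hX _)
    (Finset.prod_le_prod' fun j hj => ?_)
  rw [Finset.mem_range] at hj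
  rw [map_div₀, map_pow, map_pow, map_one_sub_X_pow_three_mul hnm h1 (by omega), one_pow, div_one]

theorem map_seqA_le_one (hnm : n = 3 * m + 1) (hX : v X = 1)
    (h1 : ∀ j, ¬ n ∣ j → v (1 - X ^ j) = 1) (hm : m ≠ 0) {k : ℕ} (hk : k < n) :
    v (seqA k) ≤ 1 :=
  (map_seqA_le hnm hX h1 hm hk).trans
    (Finset.prod_le_one' fun _ _ => pow_le_one' (v.map_one_sub_X_pow_le_one hX _) 6)

theorem map_seqA_le_pow_six (hnm : n = 3 * m + 1) (hX : v X = 1)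
    (h1 : ∀ j, ¬ n ∣ j → v (1 - X ^ j) = 1) (hm : m ≠ 0) {k : ℕ} (hk : k < n) (hmk : m < k) :
    v (seqA k) ≤ v (1 - X ^ n) ^ 6 := by
  refine (map_seqA_le hnm hX h1 hm hk).trans ?_
  rw [← Finset.mul_prod_erase _ _ (Finset.mem_range.2 hmk), ← hnm]
  exact mul_le_of_le_one_right'
    (Finset.prod_le_one' fun _ _ => pow_le_one' (v.map_one_sub_X_pow_le_one hX _) 6)

theorem map_sum_triples_sub_le (hnm : n = 3 * m + 1) (hX : v X = 1)
    (h1 : ∀ j, ¬ n ∣ j → v (1 - X ^ j) = 1) (hm : m ≠ 0) :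
    v (∑ t ∈ (Finset.range n ×ˢ Finset.range n ×ˢ Finset.range n).filter
          (fun t => t.1 + t.2.1 + t.2.2 ≤ n - 1), seqA t.1 * seqA t.2.1 * seqA t.2.2 -
        (∑ k ∈ Finset.range (m + 1), seqA k) ^ 3) ≤ v (1 - X ^ n) ^ 6 := by
  have hcube : (∑ k ∈ Finset.range (m + 1), seqA k) ^ 3 =
      ∑ t ∈ Finset.range (m + 1) ×ˢ Finset.range (m + 1) ×ˢ Finset.range (m + 1),
        seqA t.1 * seqA t.2.1 * seqA t.2.2 := by
    simp only [Finset.sum_product, pow_succ, pow_zero, one_mul, Finset.sum_mul,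
      mul_assoc, Finset.mul_sum]
    refine Finset.sum_congr rfl fun i _ => Finset.sum_congr rfl fun j _ =>
      Finset.sum_congr rfl fun k _ => ?_
    ring
  -- Three indices at most `m` add up to at most `3 * m`, which is exactly `n - 1`.
  have hsub : Finset.range (m + 1) ×ˢ Finset.range (m + 1) ×ˢ Finset.range (m + 1) ⊆
      (Finset.range n ×ˢ Finset.range n ×ˢ Finset.range n).filter
          (fun t => t.1 + t.2.1 + t.2.2 ≤ n - 1) := by
    intro t ht
    simp only [Finset.mem_product, Finset.mem_range, Finset.mem_filter] at ht ⊢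
    omega
  rw [hcube, ← Finset.sum_sdiff hsub, add_sub_cancel_right]
  refine v.map_sum_le fun t ht => ?_
  simp only [Finset.mem_sdiff, Finset.mem_product, Finset.mem_range, Finset.mem_filter] at ht
  obtain ⟨⟨⟨ht1, ht2, ht3⟩, -⟩, hlt⟩ := ht
  have o := fun {k : ℕ} (hk : k < n) => map_seqA_le_one hnm hX h1 hm hk
  have s := fun {k : ℕ} (hk : k < n) (h : m < k) => map_seqA_le_pow_six hnm hX h1 hm hk h
  rw [map_mul, map_mul]
  by_cases c1 : m < t.1
  · exact mul_le_of_le_of_le_one (mul_le_of_le_of_le_one (s ht1 c1) (o ht2)) (o ht3)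
  by_cases c2 : m < t.2.1
  · exact mul_le_of_le_of_le_one (mul_le_of_le_one_of_le (o ht1) (s ht2 c2)) (o ht3)
  · exact mul_le_of_le_one_of_le (mul_le_one' (o ht1) (o ht2)) (s ht3 (by omega))

/-- The congruence for the single sum, to fourth order. -/
theorem map_sum_seqA_sub_le (hnm : n = 3 * m + 1) (hX : v X = 1)
    (h1 : ∀ j, ¬ n ∣ j → v (1 - X ^ j) = 1) (hn : v (1 - X ^ n) < 1) (hm : m ≠ 0)
    {P T : RatFunc ℚ}
    (hP : P = (∏ j ∈ Finset.range m, (1 - X ^ (3 * j + 2))) /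
      ∏ j ∈ Finset.range m, (1 - X ^ (3 * j + 3))) (hP1 : v P ≤ 1)
    (hT : T = (1 - X ^ n) ^ 2 * ∑ j ∈ Finset.range m,
          (X ^ (3 * j + 2) / (1 - X ^ (3 * j + 2)) ^ 2 -
            X ^ (3 * j + 3) / (1 - X ^ (3 * j + 3)) ^ 2)) :
    v (∑ k ∈ Finset.range (m + 1), seqA k - qInt n * P ^ 3 * (1 + T)) ≤ v (1 - X ^ n) ^ 4 := by
  rw [← sub_add_sub_cancel _ (∑ k ∈ Finset.range (m + 1),
    jacksonTerm X (X ^ 3) (-deformation n) m k)]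
  refine v.map_add_le ?_ ?_
  · rw [← Finset.sum_sub_distrib]
    exact v.map_sum_le fun k hk => map_seqA_sub_jacksonTerm_le hnm hX h1 hn hm
      (Nat.lt_succ_iff.1 (Finset.mem_range.1 hk))
  -- The factor `qInt n` raises the third-order estimate to fourth order.
  · rw [sum_jacksonTerm_X hnm hX h1 hn, ← hP, ← mul_sub, map_mul, map_mul,
      map_qInt h1 (by omega), pow_succ' _ 3, mul_assoc, map_pow, hT]
    exact mul_le_mul_right (mul_le_of_le_one_of_le (pow_le_one' hP1 3)
      (map_deformed_value_sub_le hnm hX h1 hn)) _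

theorem map_triple_sum_sub_le (hnm : n = 3 * m + 1) (hX : v X = 1)
    (h1 : ∀ j, ¬ n ∣ j → v (1 - X ^ j) = 1) (hn : v (1 - X ^ n) < 1) (hm : m ≠ 0) :
    v (∑ t ∈ (Finset.range n ×ˢ Finset.range n ×ˢ Finset.range n).filter
          (fun t => t.1 + t.2.1 + t.2.2 ≤ n - 1), seqA t.1 * seqA t.2.1 * seqA t.2.2 -
      (qInt n ^ 3 * (qShifted (X ^ 2) (X ^ 3) m ^ 9 / qShifted (X ^ 3) (X ^ 3) m ^ 9) *
        (1 + 3 * qInt n ^ 2 * ∑ r ∈ Finset.Icc 1 m,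
          (X ^ (3 * r - 1) / qInt (3 * r - 1) ^ 2 - X ^ (3 * r) / qInt (3 * r) ^ 2)))) ≤
      v (1 - X ^ n) ^ 6 := by
  rw [mul_assoc 3, qInt_sq_mul_sum_Icc, qShifted_pow_three, qShifted_pow_three, ← div_pow,
    ← sub_add_sub_cancel _ ((∑ k ∈ Finset.range (m + 1), seqA k) ^ 3)]
  refine v.map_add_le (map_sum_triples_sub_le hnm hX h1 hm) ?_
  obtain ⟨P, hP⟩ : ∃ P : RatFunc ℚ, P = (∏ j ∈ Finset.range m, (1 - X ^ (3 * j + 2))) /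
      ∏ j ∈ Finset.range m, (1 - X ^ (3 * j + 3)) := ⟨_, rfl⟩
  obtain ⟨T, hT⟩ : ∃ T : RatFunc ℚ, T = (1 - X ^ n) ^ 2 * ∑ j ∈ Finset.range m,
      (X ^ (3 * j + 2) / (1 - X ^ (3 * j + 2)) ^ 2 -
        X ^ (3 * j + 3) / (1 - X ^ (3 * j + 3)) ^ 2) := ⟨_, rfl⟩
  have hP1 : v P ≤ 1 := by
    rw [hP, map_div₀, map_prod v (fun j => 1 - X ^ (3 * j + 3)),
      Finset.prod_eq_one (fun j hj => map_one_sub_X_pow_three_mul hnm h1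
        (by rw [Finset.mem_range] at hj; omega)), div_one]
    exact v.map_prod_le_one fun j _ => v.map_one_sub_X_pow_le_one hX _
  have hT1 : v T ≤ v (1 - X ^ n) ^ 2 := by
    rw [hT, map_mul, map_pow]
    refine mul_le_of_le_one_right' (v.map_sum_le fun j hj => ?_)
    rw [Finset.mem_range] at hj
    refine v.map_sub_le ?_ ?_
    · rw [map_div₀, map_pow, map_pow, hX, h1 (3 * j + 2) (Nat.not_dvd_of_pos_of_lt (by omega)
        (by omega))]
      simp
    · rw [map_div₀, map_pow, map_pow, hX, map_one_sub_X_pow_three_mul hnm h1 (by omega)]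
      simp
  have hS := map_sum_seqA_sub_le hnm hX h1 hn hm hP hP1 hT
  have hq := map_qInt h1 (by omega : n ≠ 1) n
  rw [← hP, ← hT]
  generalize v (1 - X ^ n) = e at *
  generalize ∑ k ∈ Finset.range (m + 1), seqA k = S at *
  generalize qInt n = N at *
  have he : ∀ {i j : ℕ}, i ≤ j → e ^ j ≤ e ^ i := fun h => pow_le_pow_right_of_le_one' hn.le h
  have hT0 : v T ≤ 1 := hT1.trans (pow_le_one' hn.le 2)
  have hR : v (N * P ^ 3 * (1 + T)) ≤ e := by
    rw [map_mul, map_mul, map_pow, hq]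
    exact mul_le_of_le_of_le_one (mul_le_of_le_of_le_one le_rfl (pow_le_one' hP1 3))
      (v.map_add_le (by simp) hT0)
  have hS1 : v S ≤ e := by
    rw [← sub_add_cancel S (N * P ^ 3 * (1 + T))]
    exact v.map_add_le (hS.trans (by simpa using he (show 1 ≤ 4 by norm_num))) hR
  have split : S ^ 3 - N ^ 3 * P ^ 9 * (1 + 3 * T) =
      (S - N * P ^ 3 * (1 + T)) * (S * S + S * (N * P ^ 3 * (1 + T)) +
        N * P ^ 3 * (1 + T) * (N * P ^ 3 * (1 + T))) + N ^ 3 * P ^ 9 * (3 + T) * T * T := by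
    ring
  rw [split]
  generalize N * P ^ 3 * (1 + T) = R at *
  refine v.map_add_le ?_ ?_
  · rw [map_mul, show 6 = 4 + 2 by norm_num, pow_add]
    refine mul_le_mul' hS ?_
    rw [pow_two]
    refine v.map_add_le (v.map_add_le ?_ ?_) ?_ <;> rw [map_mul]
    exacts [mul_le_mul' hS1 hS1, mul_le_mul' hS1 hR, mul_le_mul' hR hR]
  · have h3 : v (3 + T) ≤ 1 := by
      refine v.map_add_le ?_ hT0
      have : (3 : RatFunc ℚ) = 1 + 1 + 1 := by norm_num
      rw [this]
      exact v.map_add_le (v.map_add_le (by simp) (by simp)) (by simp)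
    rw [map_mul, map_mul, map_mul, map_mul, map_pow, map_pow, hq]
    calc e ^ 3 * v P ^ 9 * v (3 + T) * v T * v T
        ≤ e ^ 3 * 1 * 1 * e ^ 2 * e ^ 2 := by
          gcongr
          exact pow_le_one' hP1 9
      _ = e ^ 7 := by rw [mul_one, mul_one, ← pow_add, ← pow_add]
      _ ≤ e ^ 6 := he (by norm_num)

end Congruence

/-! ### The `Φ_n`-adic valuation and divisibility of numerators. -/

section Cyclotomic

open Polynomial IsDedekindDomain

/-- The numerator is `x` times a polynomial, and polynomials have valuation at most `1`. -/
theorem dvd_num_of_valuation_le (w : HeightOneSpectrum ℚ[X]) {Φ : ℚ[X]}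
    (hΦ : w.asIdeal = Ideal.span {Φ}) {x : RatFunc ℚ} {k : ℕ}
    (h : w.valuation (RatFunc ℚ) x ≤ WithZero.exp (-(k : ℤ))) : Φ ^ k ∣ x.num := by
  have hx : algebraMap ℚ[X] (RatFunc ℚ) x.num = x * algebraMap ℚ[X] (RatFunc ℚ) x.denom := by
    rw [eq_comm, ← eq_div_iff (RatFunc.algebraMap_ne_zero x.denom_ne_zero), x.num_div_denom]
  have hle : w.valuation (RatFunc ℚ) (algebraMap ℚ[X] (RatFunc ℚ) x.num) ≤
      WithZero.exp (-(k : ℤ)) := by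
    rw [hx, map_mul]
    exact mul_le_of_le_of_le_one h (w.valuation_le_one _)
  rw [w.valuation_of_algebraMap, w.intValuation_le_pow_iff_dvd, hΦ, Ideal.span_singleton_pow,
    Ideal.dvd_span_singleton, Ideal.mem_span_singleton] at hle
  exact hle

/-- `X ^ j - 1` is the product of the cyclotomic polynomials of index dividing `j`, and those of
different index are coprime over `ℚ`. -/
theorem cyclotomic_rat_not_dvd_one_sub_X_pow {n j : ℕ} (hn : 0 < n) (hj : ¬ n ∣ j) :
    ¬ cyclotomic n ℚ ∣ 1 - X ^ j := by
  have hj0 : 0 < j := Nat.pos_of_ne_zero fun h => hj (h ▸ dvd_zero n)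
  rw [← dvd_neg, neg_sub, ← prod_cyclotomic_eq_X_pow_sub_one hj0,
    (cyclotomic.irreducible_rat hn).prime.dvd_finsetProd_iff]
  rintro ⟨d, hd, h⟩
  have hdn : n ≠ d := fun h => hj (h ▸ (Nat.mem_divisors.1 hd).1)
  exact (cyclotomic.irreducible_rat hn).not_isUnit
    ((cyclotomic.isCoprime_rat hdn).isUnit_of_dvd h)

end Cyclotomic

theorem theorem1p3 (n : ℕ) (hn : 0 < n) (hmod : n ≡ 1 [MOD 3]) :
    RatCongr (Polynomial.cyclotomic n ℚ ^ 6)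
      (∑ t ∈ (Finset.range n ×ˢ Finset.range n ×ˢ Finset.range n).filter
          (fun t => t.1 + t.2.1 + t.2.2 ≤ n - 1),
        seqA t.1 * seqA t.2.1 * seqA t.2.2)
      (qInt n ^ 3 *
        (qShifted (RatFunc.X ^ 2) (RatFunc.X ^ 3) ((n - 1) / 3) ^ 9 /
          qShifted (RatFunc.X ^ 3) (RatFunc.X ^ 3) ((n - 1) / 3) ^ 9) *
        (1 + 3 * qInt n ^ 2 *
          ∑ r ∈ Finset.Icc 1 ((n - 1) / 3),
            (RatFunc.X ^ (3 * r - 1) / qInt (3 * r - 1) ^ 2 -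
              RatFunc.X ^ (3 * r) / qInt (3 * r) ^ 2))) := by
  obtain ⟨m, hnm⟩ : ∃ m, n = 3 * m + 1 := by
    have : n % 3 = 1 := hmod
    exact ⟨n / 3, by omega⟩
  have hm : (n - 1) / 3 = m := by omega
  rw [hm, RatCongr]
  -- For `n = 1` the denominator `1 - X` of the `q`-integers is not a unit, so the estimates fail;
  -- but then both sides equal `1`.
  rcases eq_or_ne m 0 with rfl | hm0
  · obtain rfl : n = 1 := by omega
    have h := RatFunc.one_sub_X_pow_ne_zero one_ne_zero
    rw [pow_one] at h
    simp [seqA, qInt, qShifted, h, Finset.filter_singleton]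
  have hirr := Polynomial.cyclotomic.irreducible_rat hn
  let w : IsDedekindDomain.HeightOneSpectrum (Polynomial ℚ) :=
    ⟨Ideal.span {Polynomial.cyclotomic n ℚ},
      (Ideal.span_singleton_prime hirr.ne_zero).2 hirr.prime,
      by simpa using hirr.ne_zero⟩
  have hw : ∀ j : ℕ, w.valuation (RatFunc ℚ) (1 - RatFunc.X ^ j) =
      w.intValuation (1 - Polynomial.X ^ j) := by
    intro j
    rw [← w.valuation_of_algebraMap (K := RatFunc ℚ)]
    simp
  have hone : ∀ {p : Polynomial ℚ}, ¬ Polynomial.cyclotomic n ℚ ∣ p → w.intValuation p = 1 := by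
    intro p hp
    rw [IsDedekindDomain.HeightOneSpectrum.intValuation_eq_one_iff]
    exact fun h => hp (Ideal.mem_span_singleton.1 h)
  have hlt : w.valuation (RatFunc ℚ) (1 - RatFunc.X ^ n) ≤ WithZero.exp (-((1 : ℕ) : ℤ)) := by
    rw [hw, w.intValuation_le_pow_iff_dvd, pow_one, Ideal.dvd_span_singleton]
    refine Ideal.mem_span_singleton.2 ?_
    rw [← dvd_neg, neg_sub]
    exact Polynomial.cyclotomic.dvd_X_pow_sub_one n ℚ
  have hX : w.valuation (RatFunc ℚ) RatFunc.X = 1 := by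
    rw [← RatFunc.algebraMap_X, w.valuation_of_algebraMap]
    refine hone fun h => ?_
    have h' := h.trans (dvd_pow_self _ hn.ne')
    have h1 : Polynomial.cyclotomic n ℚ ∣ Polynomial.X ^ n - 1 :=
      Polynomial.cyclotomic.dvd_X_pow_sub_one n ℚ
    exact hirr.not_isUnit (isUnit_of_dvd_one ((dvd_sub_right h').1 h1))
  refine dvd_num_of_valuation_le w rfl ((map_triple_sum_sub_le hnm hX
    (fun j hj => ?_) (hlt.trans_lt ?_) hm0).trans ?_)
  · rw [hw]
    exact hone (cyclotomic_rat_not_dvd_one_sub_X_pow hn hj)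
  · rw [← WithZero.exp_zero, WithZero.exp_lt_exp]
    norm_num
  · refine (pow_le_pow_left' hlt 6).trans_eq ?_
    rw [← WithZero.exp_nsmul]
    norm_num
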